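/- Let $d\in\mathbb N$ and let $\Sigma\in\mathbb R^{d\times d}$ be a (symmetric) positive definite correlation matrix, i.e. $\Sigma_{ii}=1$ for all $i$. Let $\mathcal B$ be a standard $d$-dimensional Brownian motion and let $(z_t)_{t\ge 0}$ be a continuous solution of the correlated Ornstein–Uhlenbeck equation $$dz_t=-z_t\,dt+\sqrt2\,\Sigma^{1/2}\,d\mathcal B_t ,$$ started from a random vector $z_0=(z_0^1,\dots,z_0^d)$ that is independent of $\mathcal B$ and each of whose coordinates $z_0^i$ is standard normal (the joint law of $z_0$ is otherwise arbitrary). Let $\Phi$ be the standard normal CDF. The copula of a law on $\mathbb R^d$ with continuous marginal CDFs $F_1,\dots,F_d$ is the law of $(F_1(X_1),\dots,F_d(X_d))$, where $X$ has the given law; the Gaussian copula $c_\Sigma$ with correlation matrix $\Sigma$ is the copula of $\mathcal N(0,\Sigma)$. Then: 1. $u_t^i:=\Phi(z_t^i)$ is uniformly distributed on $(0,1)$ for all $t\ge 0$ and all $i\in\{1,\dots,d\}$. 2. The copula $c_t$ of $z_t$ satisfies $\mathrm{KL}(c_t\,\|\,c_\Sigma)\to 0$ as $t\to\infty$, with $\mathrm{KL}(c_t\,\|\,c_\Sigma)=\mathcal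 O(e^{-2t})$; that is, there is a constant $C$ such that $\mathrm{KL}(c_t\,\|\,c_\Sigma)\le C e^{-2t}$ for all sufficiently large $t$. -/

import Mathlib

open MeasureTheory ProbabilityTheory Filter Topology
open scoped NNReal ENNReal

/-- The square root `S^{1/2}` of a positive semidefinite matrix, acting on `ℝ^d`. -/
noncomputable def sqrtMatrixCLM {d : ℕ} (S : Matrix (Fin d) (Fin d) ℝ) :
    EuclideanSpace ℝ (Fin d) →L[ℝ] EuclideanSpace ℝ (Fin d) :=
  open scoped MatrixOrder in Matrix.toEuclideanCLM (𝕜 := ℝ) (CFC.sqrt S)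

/-- A standard `d`-dimensional Brownian motion: its coordinate processes are independent
one-dimensional Brownian motions (started at `0`, with almost surely continuous paths). -/
structure IsBrownianVec {Ω : Type*} [MeasurableSpace Ω] {d : ℕ}
    (B : ℝ≥0 → Ω → EuclideanSpace ℝ (Fin d)) (P : Measure Ω) : Prop where
  measurable : ∀ t, Measurable (B t)
  coord : ∀ i, IsBrownianReal (fun t ω => B t ω i) P
  indep : iIndepFun (fun i ω (t : ℝ≥0) => B t ω i) P

/-- `z` solves `dz_t = -z_t dt + √2 S^{1/2} dB_t`, `t ≥ 0`, where the driving Brownian motion `B`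
is independent of the initial value `z_0`. As the noise coefficient is constant, the integral form
of the equation is `z_t = z_0 - ∫_0^t z_s ds + √2 S^{1/2} B_t`. -/
structure IsCorrelatedOU {Ω : Type*} [MeasurableSpace Ω] {d : ℕ}
    (S : Matrix (Fin d) (Fin d) ℝ) (B z : ℝ≥0 → Ω → EuclideanSpace ℝ (Fin d))
    (P : Measure Ω) : Prop where
  brownian : IsBrownianVec B P
  measurable : ∀ t, Measurable (z t)
  continuous_paths : ∀ᵐ ω ∂P, Continuous (fun t => z t ω)
  indep_initial : IndepFun (z 0) (fun ω (t : ℝ≥0) => B t ω) P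
  integral_eq : ∀ᵐ ω ∂P, ∀ t : ℝ≥0,
    z t ω = z 0 ω - (∫ s in (0 : ℝ)..t, z s.toNNReal ω) + √2 • sqrtMatrixCLM S (B t ω)

/-- The CDF of the `i`-th marginal of a distribution on `ℝ^d`. -/
noncomputable def marginalCDF {d : ℕ} (μ : Measure (EuclideanSpace ℝ (Fin d))) (i : Fin d)
    (x : ℝ) : ℝ :=
  cdf (μ.map (fun y => y i)) x

/-- The copula of a distribution `μ` on `ℝ^d` with continuous marginal CDFs `F_1, …, F_d`:
the joint law of `(F_1(X_1), …, F_d(X_d))` for `X` distributed as `μ`. -/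
noncomputable def copulaOf {d : ℕ} (μ : Measure (EuclideanSpace ℝ (Fin d))) :
    Measure (Fin d → ℝ) :=
  μ.map (fun x i => marginalCDF μ i (x i))

/-- The Gaussian copula with correlation matrix `S`: the copula of `N(0, S)`. -/
noncomputable def gaussianCopula {d : ℕ} (S : Matrix (Fin d) (Fin d) ℝ) :
    Measure (Fin d → ℝ) :=
  copulaOf (multivariateGaussian 0 S)

theorem measurable_marginalCDF {d : ℕ} (μ : Measure (EuclideanSpace ℝ (Fin d))) (i : Fin d) :
    Measurable (marginalCDF μ i) :=
  (monotone_cdf _).measurable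

theorem measure_cdf_plateau (ν : Measure ℝ) [IsProbabilityMeasure ν] (a : ℝ) :
    ν {x | a < x ∧ cdf ν x ≤ cdf ν a} = 0 := by
  have h0 : ∀ x, cdf ν x ≤ cdf ν a → ν (Set.Ioc a x) = 0 := by
    intro x hx
    have : (cdf ν).measure (Set.Ioc a x) = 0 := by
      rw [StieltjesFunction.measure_Ioc]; simpa using hx
    rwa [measure_cdf] at this
  by_cases hM : ∃ M, (a < M ∧ cdf ν M ≤ cdf ν a) ∧ ∀ x, a < x → cdf ν x ≤ cdf ν a → x ≤ M
  · obtain ⟨M, hM1, hM2⟩ := hM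
    have hsub : {x | a < x ∧ cdf ν x ≤ cdf ν a} ⊆ Set.Ioc a M :=
      fun x hx => ⟨hx.1, hM2 x hx.1 hx.2⟩
    exact measure_mono_null hsub (h0 M hM1.2)
  · push Not at hM
    have hU : ν (⋃ q : {q : ℚ // cdf ν q ≤ cdf ν a}, Set.Ioc a (q : ℚ)) = 0 :=
      measure_iUnion_null (fun q => h0 _ q.2)
    refine measure_mono_null (fun x hx => ?_) hU
    obtain ⟨y, hy1, hy2, hy3⟩ := hM x hx
    obtain ⟨q, hq1, hq2⟩ := exists_rat_btwn hy3
    have hq : cdf ν (q : ℝ) ≤ cdf ν a := (monotone_cdf ν hq2.le).trans hy2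
    exact Set.mem_iUnion.2 ⟨⟨q, hq⟩, hx.1, hq1.le⟩

/-- Sklar's identity `P(x_1, …, x_d) = C(F_1(x_1), …, F_d(x_d))` for the copula defined above. -/
theorem copulaOf_sklar {d : ℕ} (μ : Measure (EuclideanSpace ℝ (Fin d))) [IsProbabilityMeasure μ]
    (x : EuclideanSpace ℝ (Fin d)) :
    μ {y | ∀ i, y i ≤ x i} = copulaOf μ (Set.Iic (fun i => marginalCDF μ i (x i))) := by
  have hm : Measurable (fun (y : EuclideanSpace ℝ (Fin d)) i => marginalCDF μ i (y i)) :=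
    measurable_pi_lambda _ (fun i => (measurable_marginalCDF μ i).comp (by fun_prop))
  rw [copulaOf, Measure.map_apply hm measurableSet_Iic]
  have hae : ∀ᵐ y ∂μ, ∀ i, marginalCDF μ i (y i) ≤ marginalCDF μ i (x i) → y i ≤ x i := by
    rw [ae_all_iff]
    intro i
    have hmi : Measurable (fun y : EuclideanSpace ℝ (Fin d) => y i) := by fun_prop
    have : IsProbabilityMeasure (μ.map (fun y : EuclideanSpace ℝ (Fin d) => y i)) :=
      Measure.isProbabilityMeasure_map hmi.aemeasurable
    have h := measure_cdf_plateau (μ.map (fun y : EuclideanSpace ℝ (Fin d) => y i)) (x i)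
    have h' := ae_of_ae_map hmi.aemeasurable (measure_eq_zero_iff_ae_notMem.1 h)
    filter_upwards [h'] with y hy hle
    by_contra hlt
    exact hy ⟨not_le.1 hlt, hle⟩
  refine measure_congr ?_
  filter_upwards [hae] with y hy
  exact propext ⟨fun h i => monotone_cdf _ (h i), fun h i => hy i (h i)⟩

/-! The noise is additive, so the equation is solved path by path: variation of constants and
integration by parts express the solution through ordinary integrals of the Brownian path, which are
limits of the sums `ouSum`. These sums are Gaussian and independent of the initial value; passing to
the limit in characteristic functions gives `IsCorrelatedOU.map_eq`: z_t has the law of e^{-t} z_0 +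
√(1 - q) Σ^{1/2} W, where q = e^{-2t} and W is standard normal and independent of z_0. Since Σ_ii =
1, the variances of each coordinate add up to q + (1 - q) = 1, so the marginals stay standard normal
and Φ makes them uniform.

For the entropy, all marginals being standard normal, both copulas are images under the same
coordinatewise Φ, and data processing bounds the copula divergence by that of the laws on ℝ^d. The
law of z_0 may be singular and the density of z_t unwieldy, so data processing is used once more:
z_t and N(0, Σ) are images, under (x, w) ↦ Σ^{1/2} w, of the laws of (z_0, e^{-t} Σ^{-1/2} z_0 + √(1
- q) W) and (z_0, W). Given z_0 these are explicit Gaussians, and `klDiv_prod_map_shift` computes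
their divergence as a sum over i of -log(1 - q)/2 - q/2 + q E[(Σ^{-1/2} z_0)_i²]/2, which is O(q).
Only second moments of z_0 enter, and these are finite because its marginals are normal. -/

/-! ### Sums of independent Gaussians -/

theorem hasLaw_gaussianReal_sum {Ω ι : Type*} [MeasurableSpace Ω] {P : Measure Ω}
    [IsProbabilityMeasure P] {X : ι → Ω → ℝ} {v : ι → ℝ≥0} (hX : iIndepFun X P)
    (hlaw : ∀ i, HasLaw (X i) (gaussianReal 0 (v i)) P) (s : Finset ι) :
    HasLaw (fun ω => ∑ i ∈ s, X i ω) (gaussianReal 0 (∑ i ∈ s, v i)) P := by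
  have hm : ∀ i, AEMeasurable (X i) P := fun i => (hlaw i).aemeasurable
  refine ⟨by fun_prop, ?_⟩
  refine Measure.ext_of_charFun ?_
  have h := iIndepFun.charFun_map_finsetSum_eq_prod (s := s) (fun i _ => hm i)
    (hX.precomp (g := ((↑) : s → ι)) Subtype.val_injective)
  have h2 : (fun ω => ∑ i ∈ s, X i ω) = ∑ i ∈ s, X i := by ext; simp
  rw [h2, h]
  ext x
  simp only [Finset.prod_apply, (hlaw _).map_eq, charFun_gaussianReal, ← Complex.exp_sum]
  simp [Finset.sum_mul, Finset.sum_div]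

theorem hasLaw_gaussianReal_sum_mul {Ω ι : Type*} [MeasurableSpace Ω] {P : Measure Ω}
    [IsProbabilityMeasure P] {X : ι → Ω → ℝ} {v : ι → ℝ≥0} (hX : iIndepFun X P)
    (hlaw : ∀ i, HasLaw (X i) (gaussianReal 0 (v i)) P) (a : ι → ℝ) (s : Finset ι) :
    HasLaw (fun ω => ∑ i ∈ s, a i * X i ω)
      (gaussianReal 0 (∑ i ∈ s, NNReal.mk (a i ^ 2) (sq_nonneg _) * v i)) P := by
  refine hasLaw_gaussianReal_sum (X := fun i ω => a i * X i ω) ?_ ?_ s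
  · exact hX.comp (fun i x => a i * x) (fun i => by fun_prop)
  · intro i
    have h := gaussianReal_const_mul (hlaw i) (a i)
    rw [mul_zero] at h
    exact h

/-! ### The standard normal CDF and uniform marginals -/

theorem cdf_gaussianReal_continuous : Continuous (cdf (gaussianReal 0 1)) := by
  rw [continuous_iff_continuousAt]
  intro x
  rw [(monotone_cdf _).continuousAt_iff_leftLim_eq_rightLim, StieltjesFunction.rightLim_eq]
  have h := (cdf (gaussianReal 0 1)).measure_singleton x
  have := nullSingletonClass_gaussianReal (μ := 0) one_ne_zero
  rw [measure_cdf, measure_singleton, eq_comm, ENNReal.ofReal_eq_zero] at h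
  exact le_antisymm ((monotone_cdf _).leftLim_le le_rfl) (by linarith)

theorem cdf_gaussianReal_pos (x : ℝ) : 0 < cdf (gaussianReal 0 1) x := by
  rw [cdf_eq_real, measureReal_def, ENNReal.toReal_pos_iff]
  refine ⟨pos_iff_ne_zero.2 fun h => ?_, by simp⟩
  -- Lebesgue measure is absolutely continuous with respect to the Gaussian, so a Gaussian-null
  -- half-line would be Lebesgue-null.
  have := gaussianReal_absolutelyContinuous' 0 one_ne_zero h
  simp at this

theorem cdf_gaussianReal_lt_one (x : ℝ) : cdf (gaussianReal 0 1) x < 1 := by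
  refine (cdf_le_one _ x).lt_of_ne fun h => ?_
  have h1 := (prob_compl_eq_zero_iff (μ := gaussianReal 0 1) measurableSet_Iic).2
    (by rw [← ofReal_cdf, h, ENNReal.ofReal_one] : gaussianReal 0 1 (Set.Iic x) = 1)
  have := gaussianReal_absolutelyContinuous' 0 one_ne_zero h1
  simp at this

/-- The probability integral transform for the standard normal distribution. -/
theorem map_cdf_gaussianReal :
    (gaussianReal 0 1).map (cdf (gaussianReal 0 1)) = volume.restrict (Set.Ioo (0 : ℝ) 1) := by
  have hc := cdf_gaussianReal_continuous
  have hmeas : Measurable (cdf (gaussianReal 0 1)) := hc.measurable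
  have : IsProbabilityMeasure ((gaussianReal 0 1).map (cdf (gaussianReal 0 1))) :=
    Measure.isProbabilityMeasure_map hmeas.aemeasurable
  have h1 : IsProbabilityMeasure (volume.restrict (Set.Ioo (0 : ℝ) 1)) := ⟨by simp⟩
  refine Measure.ext_of_Iic _ _ fun a => ?_
  rw [Measure.map_apply hmeas measurableSet_Iic, Measure.restrict_apply measurableSet_Iic]
  rcases le_or_gt a 0 with ha | ha
  · have e1 : cdf (gaussianReal 0 1) ⁻¹' Set.Iic a = ∅ := by
      ext x; simpa using ha.trans_lt (cdf_gaussianReal_pos x)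
    have e2 : Set.Iic a ∩ Set.Ioo 0 1 = ∅ := by
      ext x; simp; intro h h'; linarith
    simp [e1, e2]
  rcases le_or_gt 1 a with ha1 | ha1
  · have e1 : cdf (gaussianReal 0 1) ⁻¹' Set.Iic a = Set.univ := by
      ext x; simpa using (cdf_gaussianReal_lt_one x).le.trans ha1
    have e2 : Set.Iic a ∩ Set.Ioo 0 1 = Set.Ioo 0 1 := by
      ext x; simp; intro h h'; linarith
    simp [e1, e2]
  · obtain ⟨b, hb⟩ : ∃ b, cdf (gaussianReal 0 1) b = a :=
      mem_range_of_exists_le_of_exists_ge hc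
        (((tendsto_cdf_atBot (gaussianReal 0 1)).eventually_le_const ha).exists)
        (((tendsto_cdf_atTop (gaussianReal 0 1)).eventually_const_le ha1).exists)
    have e2 : Set.Iic a ∩ Set.Ioo 0 1 = Set.Ioc 0 a := by
      ext x; simp only [Set.mem_inter_iff, Set.mem_Iic, Set.mem_Ioo, Set.mem_Ioc]; grind
    have e1 : gaussianReal 0 1 (cdf (gaussianReal 0 1) ⁻¹' Set.Iic a)
        = gaussianReal 0 1 (Set.Iic b) := by
      -- The two sets can differ only on a plateau of the CDF to the right of b, which is null;
      -- strict monotonicity is not needed.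
      refine measure_congr ?_
      have h := measure_eq_zero_iff_ae_notMem.1 (measure_cdf_plateau (gaussianReal 0 1) b)
      filter_upwards [h] with x hx
      refine propext ⟨fun h => ?_, fun h => ?_⟩
      · by_contra hlt
        exact hx ⟨not_le.1 hlt, le_of_le_of_eq h hb.symm⟩
      · exact (monotone_cdf _ h).trans hb.le
    rw [e1, e2, ← ofReal_cdf, hb]
    simp

theorem isUniform_cdf_gaussianReal {Ω : Type*} [MeasurableSpace Ω] {P : Measure Ω} {X : Ω → ℝ}
    (hX : HasLaw X (gaussianReal 0 1) P) :
    pdf.IsUniform (fun ω => cdf (gaussianReal 0 1) (X ω)) (Set.Ioo (0 : ℝ) 1) P volume := by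
  have hmeas : Measurable (cdf (gaussianReal 0 1)) := (monotone_cdf _).measurable
  have : P.map (fun ω => cdf (gaussianReal 0 1) (X ω))
      = (P.map X).map (cdf (gaussianReal 0 1)) :=
    (AEMeasurable.map_map_of_aemeasurable hmeas.aemeasurable hX.aemeasurable).symm
  rw [pdf.IsUniform, this, hX.map_eq, map_cdf_gaussianReal]
  simp [ProbabilityTheory.cond]

/-- The product of probability measures with densities has the product density. -/
theorem pi_withDensity {ι : Type*} [Fintype ι] {X : ι → Type*} [∀ i, MeasurableSpace (X i)]
    (ν : ∀ i, Measure (X i)) [∀ i, IsProbabilityMeasure (ν i)] (f : ∀ i, X i → ℝ≥0∞)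
    (hf : ∀ i, Measurable (f i)) [∀ i, SigmaFinite ((ν i).withDensity (f i))] :
    Measure.pi (fun i => (ν i).withDensity (f i))
      = (Measure.pi ν).withDensity (fun x => ∏ i, f i (x i)) := by
  refine Measure.pi_eq fun s hs => ?_
  rw [withDensity_apply _ (MeasurableSet.univ_pi hs),
    ← lintegral_indicator (MeasurableSet.univ_pi hs)]
  have hg : ∀ i, Measurable ((s i).indicator (f i)) := fun i => (hf i).indicator (hs i)
  have h1 : ∀ x, (Set.univ.pi s).indicator (fun x => ∏ i, f i (x i)) x
      = ∏ i, (s i).indicator (f i) (x i) := by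
    intro x
    by_cases hx : x ∈ Set.univ.pi s
    · rw [Set.indicator_of_mem hx]
      exact Finset.prod_congr rfl fun i _ => (Set.indicator_of_mem (hx i trivial) _).symm
    · rw [Set.indicator_of_notMem hx]
      obtain ⟨i, hi⟩ : ∃ i, x i ∉ s i := by simpa using hx
      exact (Finset.prod_eq_zero (Finset.mem_univ i) (Set.indicator_of_notMem hi _)).symm
  simp_rw [h1]
  rw [lintegral_prod_eq_prod_lintegral_of_indepFun Finset.univ
    (fun i (x : ∀ i, X i) => (s i).indicator (f i) (x i))
    (iIndepFun_pi fun i => (hg i).aemeasurable) (fun i => (hg i).comp (measurable_pi_apply i))]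
  refine Finset.prod_congr rfl fun i _ => ?_
  rw [withDensity_apply _ (hs i), ← lintegral_indicator (hs i),
    ← (measurePreserving_eval ν i).lintegral_comp (hg i)]

/-! ### Pathwise stochastic integral and variation of constants -/

/-- Discretisation of the stochastic integral `∫_0^t e^{-(t-s)} db_s` over `n` steps. -/
noncomputable def ouSum {E : Type*} [AddCommGroup E] [Module ℝ E] (t : ℝ≥0) (n : ℕ)
    (b : ℝ≥0 → E) : E :=
  ∑ k ∈ Finset.range n, Real.exp (-((t : ℝ) - (k / n : ℝ≥0) * t)) •
    (b ((k + 1 : ℕ) / n * t) - b (k / n * t))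

theorem sum_range_smul_sub_by_parts {E : Type*} [AddCommGroup E] [Module ℝ E] (c : ℕ → ℝ)
    (f : ℕ → E) (n : ℕ) :
    ∑ k ∈ Finset.range n, c k • (f (k + 1) - f k)
      = c n • f n - c 0 • f 0 - ∑ k ∈ Finset.range n, (c (k + 1) - c k) • f (k + 1) := by
  induction n with
  | zero => simp
  | succ n ih => rw [Finset.sum_range_succ, ih, Finset.sum_range_succ]; module

section Pathwise

variable {E : Type*} [NormedAddCommGroup E] [NormedSpace ℝ E] [CompleteSpace E]

theorem integral_exp_neg_sub (t a b : ℝ) :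
    ∫ s in a..b, Real.exp (-(t - s)) = Real.exp (-(t - b)) - Real.exp (-(t - a)) := by
  have h : ∀ s ∈ Set.uIcc a b, HasDerivAt (fun s => Real.exp (-(t - s))) (Real.exp (-(t - s))) s := by
    intro s _
    simpa using (((hasDerivAt_id s).const_sub t).neg).exp
  exact intervalIntegral.integral_eq_sub_of_hasDerivAt h
    (Continuous.intervalIntegrable (by fun_prop) _ _)

/-- Abel summation moves the differences from b to the smooth exponential weight, whose increments
are integrals of itself. What remains is a Riemann sum with b sampled at right endpoints, so uniform
continuity of b suffices and bounded variation is not needed. -/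
theorem tendsto_ouSum (t : ℝ≥0) {b : ℝ≥0 → E} (hb : Continuous b) (hb0 : b 0 = 0) :
    Tendsto (fun n => ouSum t n b) atTop
      (𝓝 (b t - ∫ s in (0 : ℝ)..t, Real.exp (-(t - s)) • b s.toNNReal)) := by
  set g : ℝ → E := fun s => b s.toNNReal with hg
  have hgc : Continuous g := hb.comp continuous_real_toNNReal
  have hF : Continuous fun s => Real.exp (-(t - s)) • g s := by fun_prop
  rw [Metric.tendsto_atTop]
  intro ε hε
  have huc := (isCompact_Icc (a := (0 : ℝ)) (b := t)).uniformContinuousOn_of_continuous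
    hgc.continuousOn
  -- The cells have total length t and the weight is at most 1, so the error is at most ε/2; t + 1
  -- instead of t covers t = 0.
  obtain ⟨δ, hδ, hδ'⟩ := Metric.uniformContinuousOn_iff.1 huc (ε / 2 / (t + 1)) (by positivity)
  obtain ⟨N, hN⟩ := exists_nat_gt ((t : ℝ) / δ)
  refine ⟨N + 1, fun n hn => ?_⟩
  have hn0 : (0 : ℝ) < n := by exact_mod_cast (by omega : 0 < n)
  have hnδ : (t : ℝ) / n < δ := by
    rw [div_lt_iff₀ hn0]
    rw [div_lt_iff₀ hδ] at hN
    have : (N : ℝ) ≤ n := by exact_mod_cast (by omega : N ≤ n)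
    nlinarith
  set p : ℕ → ℝ := fun k => k / n * t with hp
  have hpmono : Monotone p := fun i j hij => by
    simp only [hp]; gcongr
  have hstep : ∀ k, p (k + 1) - p k = t / n := by
    intro k; simp only [hp]; push_cast; field_simp; ring
  have hp0 : p 0 = 0 := by simp [hp]
  have hpn : p n = t := by simp [hp, hn0.ne']
  have hbp : ∀ k : ℕ, b (k / n * t) = g (p k) := by
    intro k
    simp only [hg, hp]
    congr 1
    rw [← NNReal.coe_inj, Real.coe_toNNReal _ (by positivity)]
    push_cast; rfl
  have hsum : ouSum t n b = g t - ∑ k ∈ Finset.range n,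
      ∫ s in p k..p (k + 1), Real.exp (-(t - s)) • g (p (k + 1)) := by
    have h1 : ouSum t n b = ∑ k ∈ Finset.range n,
        Real.exp (-(t - p k)) • (g (p (k + 1)) - g (p k)) := by
      refine Finset.sum_congr rfl fun k _ => ?_
      rw [hbp, hbp]
      simp [hp]
    rw [h1, sum_range_smul_sub_by_parts (fun k => Real.exp (-(t - p k))) (fun k => g (p k)), hpn,
      hp0]
    have : g 0 = 0 := by simp [hg, hb0]
    simp only [this, smul_zero, sub_self, neg_zero, Real.exp_zero, one_smul, sub_zero]
    congr 1
    refine Finset.sum_congr rfl fun k _ => ?_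
    rw [intervalIntegral.integral_smul_const, integral_exp_neg_sub]
  have hint : ∫ s in (0 : ℝ)..t, Real.exp (-(t - s)) • g s
      = ∑ k ∈ Finset.range n, ∫ s in p k..p (k + 1), Real.exp (-(t - s)) • g s := by
    rw [intervalIntegral.sum_integral_adjacent_intervals
      (fun k _ => hF.intervalIntegrable _ _), hp0, hpn]
  have hgt : b t = g t := by simp [hg]
  rw [hsum, hgt, hint, dist_eq_norm, sub_sub_sub_cancel_left, ← Finset.sum_sub_distrib]
  have hk : ∀ k ∈ Finset.range n, ‖(∫ s in p k..p (k + 1), Real.exp (-(t - s)) • g s)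
      - ∫ s in p k..p (k + 1), Real.exp (-(t - s)) • g (p (k + 1))‖
        ≤ ε / 2 / (t + 1) * (t / n) := by
    intro k hk
    have hkn : k + 1 ≤ n := Finset.mem_range.1 hk
    rw [← intervalIntegral.integral_sub (hF.intervalIntegrable _ _)
      (Continuous.intervalIntegrable (by fun_prop) _ _)]
    have hle : p k ≤ p (k + 1) := hpmono (Nat.le_succ k)
    rw [← hstep k, ← abs_of_nonneg (sub_nonneg.2 hle)]
    refine intervalIntegral.norm_integral_le_of_norm_le_const fun s hs => ?_
    rw [Set.uIoc_of_le hle] at hs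
    have h0 : 0 ≤ p k := by rw [← hp0]; exact hpmono (Nat.zero_le k)
    have h1 : p (k + 1) ≤ t := by rw [← hpn]; exact hpmono hkn
    rw [← smul_sub, norm_smul, Real.norm_of_nonneg (Real.exp_pos _).le]
    have he : Real.exp (-(t - s)) ≤ 1 := Real.exp_le_one_iff.2 (by linarith [hs.2])
    have hd : ‖g s - g (p (k + 1))‖ < ε / 2 / (t + 1) := by
      rw [← dist_eq_norm]
      refine hδ' s ⟨by linarith [hs.1], by linarith [hs.2]⟩ _ ⟨by linarith, h1⟩ ?_
      rw [Real.dist_eq, abs_sub_comm, abs_of_nonneg (by linarith [hs.2])]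
      linarith [hstep k, hs.1]
    calc _ ≤ 1 * (ε / 2 / (t + 1)) := by gcongr
      _ = _ := one_mul _
  calc _ ≤ ∑ k ∈ Finset.range n, ε / 2 / (t + 1) * (t / n) := norm_sum_le_of_le _ hk
    _ = ε / 2 * (t / (t + 1)) := by simp; field_simp
    _ ≤ ε / 2 * 1 := by
      gcongr
      exact (div_le_one (by positivity)).2 (by linarith)
    _ < ε := by linarith

/-- Variation of constants for `z_t = z_0 - ∫_0^t z_s ds + f_t`. -/
theorem eq_exp_smul_of_integral_eq {z f : ℝ≥0 → E} (hz : Continuous z) (hf : Continuous f)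
    (h : ∀ t : ℝ≥0, z t = z 0 - (∫ s in (0 : ℝ)..t, z s.toNNReal) + f t) (t : ℝ≥0) :
    z t = Real.exp (-(t : ℝ)) • z 0
      + (f t - ∫ s in (0 : ℝ)..t, Real.exp (-(t - s)) • f s.toNNReal) := by
  have hzc : Continuous fun s : ℝ => z s.toNNReal := hz.comp continuous_real_toNNReal
  have hfc : Continuous fun s : ℝ => f s.toNNReal := hf.comp continuous_real_toNNReal
  -- y = z - f is differentiable even when z and f are not, and y' = -y - f is solved with the
  -- integrating factor e^{-(t - r)}.
  set y : ℝ → E := fun r => z 0 - ∫ s in (0 : ℝ)..r, z s.toNNReal with hy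
  have hyd : ∀ r, HasDerivAt y (-z r.toNNReal) r := fun r =>
    (intervalIntegral.integral_hasDerivAt_right (hzc.intervalIntegrable _ _)
      (hzc.stronglyMeasurableAtFilter _ _) hzc.continuousAt).const_sub _
  have hder : ∀ r ∈ Set.uIcc (0 : ℝ) t,
      HasDerivAt (fun r => Real.exp (-(t - r)) • y r)
        (-(Real.exp (-(t - r)) • f r.toNNReal)) r := by
    intro r hr
    rw [Set.uIcc_of_le (NNReal.coe_nonneg t)] at hr
    have he : HasDerivAt (fun s : ℝ => Real.exp (-(t - s))) (Real.exp (-(t - r))) r := by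
      simpa using (((hasDerivAt_id r).const_sub (t : ℝ)).neg).exp
    have hzr : z r.toNNReal = y r + f r.toNNReal := by
      rw [h r.toNNReal, Real.coe_toNNReal _ hr.1]
    exact (he.smul (hyd r)).congr_deriv (by rw [hzr]; module)
  have hint := intervalIntegral.integral_eq_sub_of_hasDerivAt hder
    (Continuous.intervalIntegrable (by fun_prop) _ _)
  have hzt : z t = y t + f t := h t
  have hy0 : y 0 = z 0 := by simp [hy]
  rw [intervalIntegral.integral_neg] at hint
  simp only [sub_self, neg_zero, Real.exp_zero, one_smul, hy0, sub_zero] at hint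
  rw [hzt, sub_eq_add_neg (f t), hint]
  module

end Pathwise

/-! ### Laws of the discretised integrals and their limits -/

/-- The variance of `ouSum t n` of a standard Brownian motion. -/
noncomputable def ouVar (t : ℝ≥0) (n : ℕ) : ℝ≥0 :=
  ∑ k ∈ Finset.range n,
    NNReal.mk (Real.exp (-((t : ℝ) - (k / n : ℝ≥0) * t)) ^ 2) (sq_nonneg _) * (t / n)

/-- Squaring the weights doubles the exponent, so `ouVar t n` is half of `ouSum (2 * t) n` along the
path s ↦ s. The limit of the latter is read off from variation of constants, because 1 - e^{-s}
solves the integral equation with forcing s. -/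
theorem tendsto_ouVar (t : ℝ≥0) :
    Tendsto (fun n => (ouVar t n : ℝ)) atTop (𝓝 ((1 - Real.exp (-(2 * (t : ℝ)))) / 2)) := by
  have hb : Continuous fun s : ℝ≥0 => (s : ℝ) := NNReal.continuous_coe
  have h := tendsto_ouSum (2 * t) hb rfl
  have hz : Continuous fun s : ℝ≥0 => 1 - Real.exp (-(s : ℝ)) := by fun_prop
  have hv := eq_exp_smul_of_integral_eq hz hb (fun r => ?_) (2 * t)
  · simp only [NNReal.coe_zero, neg_zero, Real.exp_zero, sub_self, smul_zero, zero_add] at hv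
    rw [← hv] at h
    have h2 := h.div_const 2
    push_cast at h2
    refine h2.congr fun n => ?_
    rw [ouSum, ouVar, Finset.sum_div]
    push_cast
    refine Finset.sum_congr rfl fun k _ => ?_
    rw [← Real.exp_nat_mul, smul_eq_mul]
    rcases eq_or_ne n 0 with rfl | hn
    · simp
    have hn : (n : ℝ) ≠ 0 := by exact_mod_cast hn
    have e : ((2 : ℕ) : ℝ) * -((t : ℝ) - k / n * t) = -(2 * t - k / n * (2 * t)) := by
      push_cast; ring
    rw [e]
    field_simp
    ring
  · have hi : ∫ s in (0 : ℝ)..r, (1 - Real.exp (-(s.toNNReal : ℝ)))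
        = ∫ s in (0 : ℝ)..r, (1 - Real.exp (-s)) := by
      refine intervalIntegral.integral_congr fun s hs => ?_
      rw [Set.uIcc_of_le (NNReal.coe_nonneg r)] at hs
      simp only [Real.coe_toNNReal _ hs.1]
    have hd : ∀ s ∈ Set.uIcc (0 : ℝ) r,
        HasDerivAt (fun s => s + Real.exp (-s)) (1 - Real.exp (-s)) s := by
      intro s _
      have := (hasDerivAt_id s).add (hasDerivAt_neg s).exp
      exact this.congr_deriv (by ring)
    rw [hi, intervalIntegral.integral_eq_sub_of_hasDerivAt hd
      (Continuous.intervalIntegrable (by fun_prop) _ _)]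
    simp
    ring

theorem hasLaw_ouSum {Ω : Type*} [MeasurableSpace Ω] {P : Measure Ω} [IsProbabilityMeasure P]
    {X : ℝ≥0 → Ω → ℝ} (hX : IsPreBrownianReal X P) (t : ℝ≥0) (n : ℕ) :
    HasLaw (fun ω => ouSum t n (fun s => X s ω)) (gaussianReal 0 (ouVar t n)) P := by
  have hmono : Monotone fun k : ℕ => (k / n * t : ℝ≥0) := fun i j hij => by
    dsimp only; gcongr
  have hind := hX.hasIndepIncrements.nat hmono
  refine hasLaw_gaussianReal_sum_mul (v := fun _ => t / n) hind (fun k => ?_)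
    (fun k => Real.exp (-((t : ℝ) - (k / n : ℝ≥0) * t))) (Finset.range n)
  have h := hX.hasLaw_sub ((k + 1 : ℕ) / n * t) (k / n * t)
  refine HasLaw.congr (Y := X ((k + 1 : ℕ) / n * t) - X (k / n * t)) ?_ (ae_of_all _ fun _ => rfl)
  convert h using 2
  rw [← NNReal.coe_inj, coe_nndist, Real.dist_eq, abs_of_nonneg]
  · simp only [NNReal.val_eq_coe]
    push_cast
    ring
  · exact sub_nonneg.2 (NNReal.coe_le_coe.2 (hmono (Nat.le_succ k)))

theorem measurable_ouSum {E : Type*} [NormedAddCommGroup E] [NormedSpace ℝ E]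
    [MeasurableSpace E] [BorelSpace E] [SecondCountableTopology E] (t : ℝ≥0) (n : ℕ) :
    Measurable (fun b : ℝ≥0 → E => ouSum t n b) := by
  unfold ouSum
  fun_prop

theorem measurable_ouSum_comp {Ω E : Type*} [MeasurableSpace Ω] [NormedAddCommGroup E]
    [NormedSpace ℝ E] [MeasurableSpace E] [BorelSpace E] [SecondCountableTopology E]
    {B : ℝ≥0 → Ω → E} (hB : ∀ t, Measurable (B t)) (t : ℝ≥0) (n : ℕ) :
    Measurable fun ω => ouSum t n (fun s => B s ω) := by
  unfold ouSum
  fun_prop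

theorem charFun_map_clm {E F : Type*} [NormedAddCommGroup E] [InnerProductSpace ℝ E]
    [CompleteSpace E] [MeasurableSpace E] [BorelSpace E] [NormedAddCommGroup F]
    [InnerProductSpace ℝ F] [CompleteSpace F] [MeasurableSpace F] [BorelSpace F]
    [SecondCountableTopology F] (μ : Measure E) (L : E →L[ℝ] F) (ξ : F) :
    charFun (μ.map L) ξ = charFun μ (L.adjoint ξ) := by
  rw [charFun_apply, charFun_apply, integral_map (by fun_prop)
    (Continuous.aestronglyMeasurable (by fun_prop))]
  simp [ContinuousLinearMap.adjoint_inner_right]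

theorem charFun_map_ouSum {Ω : Type*} [MeasurableSpace Ω] {P : Measure Ω} [IsProbabilityMeasure P]
    {d : ℕ} {B : ℝ≥0 → Ω → EuclideanSpace ℝ (Fin d)} (hB : IsBrownianVec B P) (t : ℝ≥0) (n : ℕ)
    (ξ : EuclideanSpace ℝ (Fin d)) :
    charFun (P.map fun ω => ouSum t n (fun s => B s ω)) ξ
      = Complex.exp (-(ouVar t n * ‖ξ‖ ^ 2 / 2)) := by
  have hi := hB.indep.comp (fun _ b => ouSum t n b) (fun _ => measurable_ouSum t n)
  have hlaw := fun i => hasLaw_ouSum (hB.coord i).toIsPreBrownianReal t n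
  have hpi := (iIndepFun_iff_map_fun_eq_pi_map (fun i => (hlaw i).aemeasurable)).1 hi
  have hR : (fun ω => ouSum t n (fun s => B s ω))
      = WithLp.toLp 2 ∘ fun ω i => ouSum t n (fun s => B s ω i) := by
    ext ω i
    simp [ouSum]
  rw [hR, ← AEMeasurable.map_map_of_aemeasurable (by fun_prop)
    (aemeasurable_pi_lambda _ fun i => (hlaw i).aemeasurable)]
  change charFun ((P.map fun ω i => ouSum t n (fun s => B s ω i)).map _) ξ = _
  have hpi' : (P.map fun ω i => ouSum t n (fun s => B s ω i))
      = Measure.pi fun _ : Fin d => gaussianReal 0 (ouVar t n) :=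
    hpi.trans (congrArg Measure.pi (funext fun i => (hlaw i).map_eq))
  rw [hpi', charFun_pi]
  simp_rw [charFun_gaussianReal, ← Complex.exp_sum, ← Complex.ofReal_pow,
    EuclideanSpace.real_norm_sq_eq]
  simp [Finset.mul_sum, Finset.sum_div]

theorem tendsto_charFun_map {Ω E : Type*} [MeasurableSpace Ω] {P : Measure Ω} [IsFiniteMeasure P]
    [NormedAddCommGroup E] [InnerProductSpace ℝ E] [MeasurableSpace E] [BorelSpace E]
    [SecondCountableTopology E] {Y : ℕ → Ω → E} {X : Ω → E} (hY : ∀ n, AEMeasurable (Y n) P)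
    (hX : AEMeasurable X P) (h : ∀ᵐ ω ∂P, Tendsto (fun n => Y n ω) atTop (𝓝 (X ω))) (ξ : E) :
    Tendsto (fun n => charFun (P.map (Y n)) ξ) atTop (𝓝 (charFun (P.map X) ξ)) := by
  have hc : Continuous fun x : E => Complex.exp (inner ℝ x ξ * Complex.I) := by fun_prop
  simp_rw [charFun_apply]
  rw [integral_map hX hc.aestronglyMeasurable]
  simp_rw [fun n => integral_map (hY n) hc.aestronglyMeasurable]
  refine tendsto_integral_of_dominated_convergence (fun _ => 1) (fun n => ?_)
    (integrable_const _) (fun n => ?_) ?_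
  · exact (hc.measurable.comp_aemeasurable (hY n)).aestronglyMeasurable
  · exact ae_of_all _ fun ω => by rw [Complex.norm_exp_ofReal_mul_I]
  · filter_upwards [h] with ω hω
    exact (hc.tendsto _).comp hω

/-! ### Law of the Ornstein–Uhlenbeck process -/

section OU

variable {Ω : Type*} [MeasurableSpace Ω] {P : Measure Ω} {d : ℕ}
  {S : Matrix (Fin d) (Fin d) ℝ} {B z : ℝ≥0 → Ω → EuclideanSpace ℝ (Fin d)}

theorem adjoint_sqrtMatrixCLM (S : Matrix (Fin d) (Fin d) ℝ) :
    (sqrtMatrixCLM S).adjoint = sqrtMatrixCLM S := by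
  open scoped MatrixOrder in
  have h : IsSelfAdjoint (sqrtMatrixCLM S) :=
    (CFC.sqrt_nonneg S).isSelfAdjoint.map (Matrix.toEuclideanCLM (𝕜 := ℝ))
  exact h.adjoint_eq

theorem IsBrownianVec.ae_continuous (hB : IsBrownianVec B P) :
    ∀ᵐ ω ∂P, Continuous (fun t => B t ω) ∧ B 0 ω = 0 := by
  have h1 := ae_all_iff.2 fun i => (hB.coord i).cont
  have h2 := ae_all_iff.2 fun i => (hB.coord i).toIsPreBrownianReal.eval_zero_ae_eq_zero
  filter_upwards [h1, h2] with ω h h'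
  refine ⟨?_, by ext i; exact h' i⟩
  exact (PiLp.continuous_toLp 2 _).comp (continuous_pi h)

theorem IsCorrelatedOU.ae_tendsto (hz : IsCorrelatedOU S B z P) (t : ℝ≥0) :
    ∀ᵐ ω ∂P, Tendsto (fun n => Real.exp (-(t : ℝ)) • z 0 ω
      + (√2 • sqrtMatrixCLM S) (ouSum t n (fun s => B s ω))) atTop (𝓝 (z t ω)) := by
  filter_upwards [hz.brownian.ae_continuous, hz.continuous_paths, hz.integral_eq]
    with ω ⟨hBc, hB0⟩ hzc hint
  set L : EuclideanSpace ℝ (Fin d) →L[ℝ] EuclideanSpace ℝ (Fin d) := √2 • sqrtMatrixCLM S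
  have hLc : Continuous fun s => L (B s ω) := L.continuous.comp hBc
  -- The forcing is the transformed path L B itself; L is pulled out only at the level of the finite
  -- sums.
  rw [eq_exp_smul_of_integral_eq hzc hLc hint t]
  refine tendsto_const_nhds.add ?_
  refine (tendsto_ouSum t hLc (by simp [hB0])).congr fun n => ?_
  simp [ouSum]

theorem IsCorrelatedOU.charFun_map_ouSum [IsProbabilityMeasure P] (hz : IsCorrelatedOU S B z P)
    (L : EuclideanSpace ℝ (Fin d) →L[ℝ] EuclideanSpace ℝ (Fin d)) (t : ℝ≥0) (n : ℕ)
    (ξ : EuclideanSpace ℝ (Fin d)) (c : ℝ) :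
    charFun (P.map fun ω => c • z 0 ω + L (ouSum t n (fun s => B s ω))) ξ
      = charFun (P.map (z 0)) (c • ξ) * Complex.exp (-(ouVar t n * ‖L.adjoint ξ‖ ^ 2 / 2)) := by
  have hRm : Measurable fun ω => ouSum t n (fun s => B s ω) :=
    measurable_ouSum_comp hz.brownian.measurable t n
  have hm : Measurable fun b : ℝ≥0 → EuclideanSpace ℝ (Fin d) => ouSum t n b :=
    measurable_ouSum t n
  have hψ := L.measurable.comp hm
  have hφ : Measurable fun x : EuclideanSpace ℝ (Fin d) => c • x := measurable_const_smul c
  have hind : IndepFun (fun ω => c • z 0 ω) (fun ω => L (ouSum t n (fun s => B s ω))) P :=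
    hz.indep_initial.comp hφ hψ
  refine (congrFun (hind.charFun_map_fun_add_eq_mul ((hz.measurable 0).const_smul c).aemeasurable
    (L.measurable.comp hRm).aemeasurable) ξ).trans ?_
  refine congrArg₂ (· * ·) (charFun_map_smul_comp (hz.measurable 0).aemeasurable c ξ) ?_
  rw [← Measure.map_map L.measurable hRm, charFun_map_clm, _root_.charFun_map_ouSum hz.brownian]

theorem IsCorrelatedOU.charFun_map [IsProbabilityMeasure P] (hz : IsCorrelatedOU S B z P)
    (t : ℝ≥0) (ξ : EuclideanSpace ℝ (Fin d)) :
    charFun (P.map (z t)) ξ = charFun (P.map (z 0)) (Real.exp (-(t : ℝ)) • ξ)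
      * Complex.exp (-((1 - Real.exp (-(2 * (t : ℝ)))) * ‖sqrtMatrixCLM S ξ‖ ^ 2 / 2)) := by
  have hRm : ∀ n, Measurable fun ω => ouSum t n (fun s => B s ω) :=
    fun n => measurable_ouSum_comp hz.brownian.measurable t n
  have hLm : Measurable (√2 • sqrtMatrixCLM S) := ContinuousLinearMap.measurable _
  have hYm : ∀ n, Measurable fun ω => Real.exp (-(t : ℝ)) • z 0 ω
      + (√2 • sqrtMatrixCLM S) (ouSum t n (fun s => B s ω)) := by
    intro n
    have h1 := (hz.measurable 0).const_smul (Real.exp (-(t : ℝ)))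
    have h2 := hLm.comp (hRm n)
    exact h1.add h2
  have hlim := tendsto_charFun_map (fun n => (hYm n).aemeasurable) (hz.measurable t).aemeasurable
    (hz.ae_tendsto t) ξ
  refine tendsto_nhds_unique hlim ?_
  simp_rw [hz.charFun_map_ouSum]
  refine tendsto_const_nhds.mul ((Complex.continuous_exp.tendsto _).comp ?_)
  -- The 2 from the √2 in the noise cancels the 1/2 in the limit of `ouVar`.
  have hn : ‖(√2 • sqrtMatrixCLM S).adjoint ξ‖ ^ 2 = 2 * ‖sqrtMatrixCLM S ξ‖ ^ 2 := by
    rw [map_smulₛₗ, adjoint_sqrtMatrixCLM, _root_.smul_apply, norm_smul, mul_pow]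
    simp
  have h1 := (((tendsto_ouVar t).mul_const
    (‖(√2 • sqrtMatrixCLM S).adjoint ξ‖ ^ 2)).div_const 2).neg
  have h2 := (Complex.continuous_ofReal.tendsto _).comp h1
  rw [hn] at h2
  have e : -((1 - Real.exp (-(2 * (t : ℝ))) : ℂ) * (‖sqrtMatrixCLM S ξ‖ : ℂ) ^ 2 / 2)
      = ((-((1 - Real.exp (-(2 * (t : ℝ)))) / 2 * (2 * ‖sqrtMatrixCLM S ξ‖ ^ 2) / 2) : ℝ) : ℂ) := by
    push_cast; ring
  rw [e]
  refine h2.congr fun n => ?_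
  simp only [Function.comp_apply]
  rw [← Complex.ofReal_pow, hn]
  push_cast
  rfl

/-- The law of the Ornstein–Uhlenbeck process at time `t`. -/
theorem IsCorrelatedOU.map_eq [IsProbabilityMeasure P] (hz : IsCorrelatedOU S B z P) (t : ℝ≥0) :
    P.map (z t) = ((P.map (z 0)).prod (stdGaussian (EuclideanSpace ℝ (Fin d)))).map
      (fun p => Real.exp (-(t : ℝ)) • p.1
        + √(1 - Real.exp (-(2 * (t : ℝ)))) • sqrtMatrixCLM S p.2) := by
  have hzm := hz.measurable
  have : IsProbabilityMeasure (P.map (z 0)) :=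
    Measure.isProbabilityMeasure_map (hzm 0).aemeasurable
  have : IsProbabilityMeasure (P.map (z t)) :=
    Measure.isProbabilityMeasure_map (hzm t).aemeasurable
  set L : EuclideanSpace ℝ (Fin d) →L[ℝ] EuclideanSpace ℝ (Fin d) :=
    √(1 - Real.exp (-(2 * (t : ℝ)))) • sqrtMatrixCLM S with hL
  have hLadj : L.adjoint = L := by
    rw [hL, map_smulₛₗ, adjoint_sqrtMatrixCLM]; simp
  refine Measure.ext_of_charFun (funext fun ξ => ?_)
  rw [hz.charFun_map]
  have hind : IndepFun
      (fun p : EuclideanSpace ℝ (Fin d) × EuclideanSpace ℝ (Fin d) => Real.exp (-(t : ℝ)) • p.1)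
      (fun p => L p.2) ((P.map (z 0)).prod (stdGaussian (EuclideanSpace ℝ (Fin d)))) :=
    indepFun_prod (X := fun x : EuclideanSpace ℝ (Fin d) => Real.exp (-(t : ℝ)) • x)
      (Y := fun x => L x) (by fun_prop) (by fun_prop)
  have h := congrFun (hind.charFun_map_fun_add_eq_mul (by fun_prop) (by fun_prop)) ξ
  refine Eq.trans ?_ h.symm
  have h1 := charFun_map_clm (stdGaussian (EuclideanSpace ℝ (Fin d))) L ξ
  rw [hLadj, charFun_stdGaussian] at h1
  have e1 : ((P.map (z 0)).prod (stdGaussian (EuclideanSpace ℝ (Fin d)))).map (fun p => L p.2)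
      = (stdGaussian (EuclideanSpace ℝ (Fin d))).map L := by
    rw [← Function.comp_def L, ← Measure.map_map L.measurable measurable_snd,
      measurePreserving_snd.map_eq]
  rw [Pi.mul_apply, charFun_map_smul_comp (by fun_prop), measurePreserving_fst.map_eq, e1, h1]
  congr 2
  have hn : ‖L ξ‖ ^ 2 = (1 - Real.exp (-(2 * (t : ℝ)))) * ‖sqrtMatrixCLM S ξ‖ ^ 2 := by
    rw [hL, _root_.smul_apply, norm_smul, mul_pow, Real.norm_of_nonneg (by positivity),
      Real.sq_sqrt (by simp)]
  rw [← Complex.ofReal_pow ‖L ξ‖, hn]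
  push_cast
  ring

end OU

/-! ### Relative entropy and Gaussian densities -/

theorem klDiv_withDensity_exp {α : Type*} [MeasurableSpace α] (μ ν : Measure α)
    [IsProbabilityMeasure μ] [IsProbabilityMeasure ν] {g : α → ℝ} (hg : Measurable g)
    (hμ : μ = ν.withDensity fun x => ENNReal.ofReal (Real.exp (g x))) (hi : Integrable g μ) :
    InformationTheory.klDiv μ ν = ENNReal.ofReal (∫ x, g x ∂μ) := by
  have hac : μ ≪ ν := hμ ▸ withDensity_absolutelyContinuous _ _
  have hd : μ.rnDeriv ν =ᵐ[ν] fun x => ENNReal.ofReal (Real.exp (g x)) := by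
    rw [hμ]
    exact Measure.rnDeriv_withDensity ν (by fun_prop)
  have hllr : llr μ ν =ᵐ[μ] g := by
    filter_upwards [hac.ae_le hd] with x hx
    rw [llr_def]
    simp only [hx]
    rw [ENNReal.toReal_ofReal (Real.exp_pos _).le, Real.log_exp]
  rw [InformationTheory.klDiv_of_ac_of_integrable hac (hi.congr hllr.symm),
    integral_congr_ae hllr]
  simp

/-- The logarithm of the density of `N(m, v)` with respect to `N(0, 1)`. -/
noncomputable def gaussianLogDensity (m v y : ℝ) : ℝ :=
  -(Real.log v / 2) - (y - m) ^ 2 / (2 * v) + y ^ 2 / 2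

theorem measurable_gaussianLogDensity {α : Type*} [MeasurableSpace α] {m y : α → ℝ}
    (hm : Measurable m) (hy : Measurable y) (v : ℝ) :
    Measurable fun a => gaussianLogDensity (m a) v (y a) := by
  unfold gaussianLogDensity
  fun_prop

theorem gaussianReal_eq_withDensity (m : ℝ) {v : ℝ≥0} (hv : v ≠ 0) :
    gaussianReal m v = (gaussianReal 0 1).withDensity
      (fun y => ENNReal.ofReal (Real.exp (gaussianLogDensity m v y))) := by
  have hv' : (0 : ℝ) < v := by positivity
  rw [gaussianReal_of_var_ne_zero m hv, gaussianReal_of_var_ne_zero 0 one_ne_zero,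
    ← withDensity_mul _ (measurable_gaussianPDF 0 1)
      (measurable_gaussianLogDensity measurable_const measurable_id' _).exp.ennreal_ofReal]
  congr 1
  ext y
  rw [Pi.mul_apply, gaussianPDF, gaussianPDF, ← ENNReal.ofReal_mul (gaussianPDFReal_nonneg _ _ _)]
  congr 1
  rw [gaussianPDFReal, gaussianPDFReal, gaussianLogDensity]
  have h1 : (√(2 * Real.pi * v))⁻¹ = (√(2 * Real.pi))⁻¹ * Real.exp (-(Real.log v / 2)) := by
    rw [Real.sqrt_mul (by positivity), mul_inv, Real.exp_neg, ← Real.log_sqrt hv'.le,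
      Real.exp_log (Real.sqrt_pos.2 hv')]
  rw [h1]
  simp only [NNReal.coe_one, mul_one]
  rw [mul_assoc, mul_assoc, ← Real.exp_add, ← Real.exp_add]
  congr 2
  ring

/-! ### Joint law with the initial value -/

section JointLaw

variable {X ι : Type*} [MeasurableSpace X]

theorem pi_gaussianReal_map [Fintype ι] (m : ι → ℝ) {σ : ℝ} (hσ : 0 < σ) :
    (Measure.pi fun _ : ι => gaussianReal 0 1).map (fun w i => m i + σ * w i)
      = (Measure.pi fun _ : ι => gaussianReal 0 1).withDensity
        (fun y => ENNReal.ofReal (Real.exp (∑ i, gaussianLogDensity (m i) (σ ^ 2) (y i)))) := by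
  have hv : NNReal.mk (σ ^ 2) (sq_nonneg σ) ≠ 0 := by
    rw [← NNReal.coe_ne_zero]
    exact (pow_pos hσ 2).ne'
  have h1 : ∀ i, (gaussianReal 0 1).map (fun w => m i + σ * w)
      = gaussianReal (m i) (NNReal.mk (σ ^ 2) (sq_nonneg σ)) := by
    intro i
    have : (fun w => m i + σ * w) = (fun w => m i + w) ∘ fun w => σ * w := rfl
    rw [this, ← Measure.map_map (by fun_prop) (by fun_prop), gaussianReal_map_const_mul,
      gaussianReal_map_const_add]
    simp
  rw [Measure.pi_map_pi (f := fun i w => m i + σ * w) (fun i => by fun_prop)]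
  simp_rw [h1, gaussianReal_eq_withDensity _ hv]
  have : ∀ i, IsProbabilityMeasure ((gaussianReal 0 1).withDensity fun y => ENNReal.ofReal
      (Real.exp (gaussianLogDensity (m i) (NNReal.mk (σ ^ 2) (sq_nonneg σ)) y))) := fun i => by
    rw [← gaussianReal_eq_withDensity _ hv]; infer_instance
  rw [pi_withDensity _ _ fun i =>
    (measurable_gaussianLogDensity measurable_const measurable_id' _).exp.ennreal_ofReal]
  congr 1
  ext y
  rw [Real.exp_sum, ENNReal.ofReal_prod_of_nonneg fun i _ => (Real.exp_pos _).le]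
  rfl

theorem measurable_prodMk_shift {m : X → ι → ℝ} (hm : Measurable m) (σ : ℝ) :
    Measurable fun p : X × (ι → ℝ) => (p.1, fun i => m p.1 i + σ * p.2 i) := by
  fun_prop

/-- Keeping the first component fixes the mean on each fibre, so by Fubini `pi_gaussianReal_map`
applies fibrewise. Nothing is asked of μ beyond being a probability measure. -/
theorem prod_map_shift [Fintype ι] (μ : Measure X) [IsProbabilityMeasure μ] {m : X → ι → ℝ}
    (hm : Measurable m)
    {σ : ℝ} (hσ : 0 < σ) :
    (μ.prod (Measure.pi fun _ : ι => gaussianReal 0 1)).map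
        (fun p => (p.1, fun i => m p.1 i + σ * p.2 i))
      = (μ.prod (Measure.pi fun _ : ι => gaussianReal 0 1)).withDensity
        (fun p => ENNReal.ofReal (Real.exp
          (∑ i, gaussianLogDensity (m p.1 i) (σ ^ 2) (p.2 i)))) := by
  have hmi : ∀ i, Measurable fun x => m x i := fun i => (measurable_pi_apply i).comp hm
  have hmap := measurable_prodMk_shift hm σ
  have hden : Measurable fun p : X × (ι → ℝ) => ENNReal.ofReal (Real.exp
      (∑ i, gaussianLogDensity (m p.1 i) (σ ^ 2) (p.2 i))) := by
    refine (Finset.measurable_sum _ fun i _ => ?_).exp.ennreal_ofReal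
    exact measurable_gaussianLogDensity ((hmi i).comp measurable_fst)
      ((measurable_pi_apply i).comp measurable_snd) _
  ext s hs
  rw [Measure.map_apply hmap hs, Measure.prod_apply (hmap hs), withDensity_apply _ hs,
    ← lintegral_indicator hs, lintegral_prod _ (hden.indicator hs).aemeasurable]
  refine lintegral_congr fun x => ?_
  have hsx : MeasurableSet (Prod.mk x ⁻¹' s) := measurable_prodMk_left hs
  have h := congrArg (fun ρ : Measure (ι → ℝ) => ρ (Prod.mk x ⁻¹' s)) (pi_gaussianReal_map (m x) hσ)
  simp only at h
  rw [Measure.map_apply (by fun_prop) hsx, withDensity_apply _ hsx,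
    ← lintegral_indicator hsx] at h
  exact h

theorem klDiv_prod_map_shift [Fintype ι] (μ : Measure X) [IsProbabilityMeasure μ] {m : X → ι → ℝ}
    (hm : Measurable m) (hm2 : ∀ i, MemLp (fun x => m x i) 2 μ) {σ : ℝ} (hσ : 0 < σ) :
    InformationTheory.klDiv
      ((μ.prod (Measure.pi fun _ : ι => gaussianReal 0 1)).map
        (fun p => (p.1, fun i => m p.1 i + σ * p.2 i)))
      (μ.prod (Measure.pi fun _ : ι => gaussianReal 0 1))
      = ENNReal.ofReal (∑ i : ι, (-(Real.log (σ ^ 2) / 2) - (1 - σ ^ 2) / 2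
          + (∫ x, m x i ^ 2 ∂μ) / 2)) := by
  set π := Measure.pi fun _ : ι => gaussianReal 0 1 with hπ
  have hmi : ∀ i, Measurable fun x => m x i := fun i => (measurable_pi_apply i).comp hm
  have hmap := measurable_prodMk_shift hm σ
  have hg : ∀ i, Measurable fun p : X × (ι → ℝ) =>
      gaussianLogDensity (m p.1 i) (σ ^ 2) (p.2 i) := fun i =>
    measurable_gaussianLogDensity ((hmi i).comp measurable_fst)
      ((measurable_pi_apply i).comp measurable_snd) _
  have hgs := Finset.measurable_sum Finset.univ fun i _ => hg i
  have : IsProbabilityMeasure ((μ.prod π).map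
      (fun p => (p.1, fun i => m p.1 i + σ * p.2 i))) :=
    Measure.isProbabilityMeasure_map hmap.aemeasurable
  have hw : ∀ i : ι, MemLp (fun w : ι → ℝ => w i) 2 π := fun i =>
    (memLp_id_gaussianReal (μ := 0) (v := 1) 2).comp_measurePreserving (measurePreserving_eval _ i)
  have hw1 : ∀ i : ι, ∫ w, w i ∂π = 0 := by
    intro i
    have := (measurePreserving_eval (fun _ : ι => gaussianReal 0 1) i).hasLaw.integral_eq
    rw [integral_id_gaussianReal] at this
    exact this
  have hw2 : ∀ i : ι, ∫ w, w i ^ 2 ∂π = 1 := by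
    intro i
    have h := (measurePreserving_eval (fun _ : ι => gaussianReal 0 1) i).hasLaw.variance_eq
    rw [variance_id_gaussianReal, variance_of_integral_eq_zero
      (measurable_pi_apply i).aemeasurable (hw1 i)] at h
    simpa using h
  -- Evaluated at y = m + σw, the log density is quadratic in (m, w); its cross term integrates to
  -- zero because w is centred and independent of m.
  have hexp : ∀ i (p : X × (ι → ℝ)),
      gaussianLogDensity (m p.1 i) (σ ^ 2) (m p.1 i + σ * p.2 i)
        = -(Real.log (σ ^ 2) / 2) - (1 - σ ^ 2) / 2 * p.2 i ^ 2 + m p.1 i ^ 2 / 2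
          + σ * (m p.1 i * p.2 i) := by
    intro i p
    rw [gaussianLogDensity]
    field_simp
    ring
  have i1 : ∀ i, Integrable (fun p : X × (ι → ℝ) => (1 - σ ^ 2) / 2 * p.2 i ^ 2) (μ.prod π) :=
    fun i => ((hw i).integrable_sq.comp_snd μ).const_mul _
  have i2 : ∀ i, Integrable (fun p : X × (ι → ℝ) => m p.1 i ^ 2 / 2) (μ.prod π) :=
    fun i => ((hm2 i).integrable_sq.comp_fst π).div_const _
  have i3 : ∀ i, Integrable (fun p : X × (ι → ℝ) => σ * (m p.1 i * p.2 i)) (μ.prod π) :=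
    fun i => (((hm2 i).integrable (by norm_num)).mul_prod
      ((hw i).integrable (by norm_num))).const_mul _
  have i4 : ∀ i, Integrable (fun p : X × (ι → ℝ) =>
      -(Real.log (σ ^ 2) / 2) - (1 - σ ^ 2) / 2 * p.2 i ^ 2) (μ.prod π) :=
    fun i => (integrable_const _).sub (i1 i)
  have i5 : ∀ i, Integrable (fun p : X × (ι → ℝ) =>
      -(Real.log (σ ^ 2) / 2) - (1 - σ ^ 2) / 2 * p.2 i ^ 2 + m p.1 i ^ 2 / 2) (μ.prod π) :=
    fun i => (i4 i).add (i2 i)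
  have hint : ∀ i, Integrable (fun p : X × (ι → ℝ) =>
      gaussianLogDensity (m p.1 i) (σ ^ 2) (m p.1 i + σ * p.2 i)) (μ.prod π) := by
    intro i
    simp_rw [hexp]
    exact (i5 i).add (i3 i)
  rw [klDiv_withDensity_exp _ _ hgs (prod_map_shift μ hm hσ),
    integral_map hmap.aemeasurable hgs.aestronglyMeasurable]
  · congr 1
    rw [integral_finsetSum _ fun i _ => hint i]
    refine Finset.sum_congr rfl fun i _ => ?_
    simp_rw [hexp]
    rw [integral_add (i5 i) (i3 i), integral_add (i4 i) (i2 i),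
      integral_sub (integrable_const _) (i1 i), integral_const_mul, integral_const_mul,
      integral_div, integral_prod_mul (fun x => m x i) (fun w : ι → ℝ => w i), hw1,
      integral_fun_snd (fun w : ι → ℝ => w i ^ 2), integral_fun_fst (fun x => m x i ^ 2), hw2]
    simp
  · rw [integrable_map_measure hgs.aestronglyMeasurable hmap.aemeasurable]
    exact integrable_finsetSum _ fun i _ => hint i

end JointLaw

/-! ### Marginals, copulas and the decay rate -/

section Main

variable {Ω : Type*} [MeasurableSpace Ω] {P : Measure Ω} {d : ℕ}
  {S : Matrix (Fin d) (Fin d) ℝ} {B z : ℝ≥0 → Ω → EuclideanSpace ℝ (Fin d)}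

theorem sqrtMatrixCLM_comp_self (hS : S.PosSemidef) (x : EuclideanSpace ℝ (Fin d)) :
    sqrtMatrixCLM S (sqrtMatrixCLM S x) = Matrix.toEuclideanCLM (𝕜 := ℝ) S x := by
  open scoped MatrixOrder in
  rw [sqrtMatrixCLM, ← mul_apply_eq_comp, ← map_mul,
    CFC.sqrt_mul_sqrt_self _ hS.nonneg]

theorem exists_rightInverse_sqrtMatrixCLM (hS : S.PosDef) :
    ∃ T : EuclideanSpace ℝ (Fin d) →L[ℝ] EuclideanSpace ℝ (Fin d),
      ∀ x, sqrtMatrixCLM S (T x) = x := by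
  -- The witness is Σ^{1/2} Σ^{-1}, that is Σ^{-1/2}.
  refine ⟨sqrtMatrixCLM S ∘L Matrix.toEuclideanCLM (𝕜 := ℝ) S⁻¹, fun x => ?_⟩
  rw [ContinuousLinearMap.comp_apply, sqrtMatrixCLM_comp_self hS.posSemidef,
    ← mul_apply_eq_comp, ← map_mul, Matrix.mul_nonsing_inv _ ((Matrix.isUnit_iff_isUnit_det _).1 hS.isUnit)]
  simp

theorem norm_sq_sqrtMatrixCLM (hS : S.PosSemidef) (x : EuclideanSpace ℝ (Fin d)) :
    ‖sqrtMatrixCLM S x‖ ^ 2 = x.ofLp ⬝ᵥ S.mulVec x.ofLp := by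
  rw [← real_inner_self_eq_norm_sq, ← ContinuousLinearMap.adjoint_inner_right,
    adjoint_sqrtMatrixCLM, sqrtMatrixCLM_comp_self hS, Matrix.inner_toEuclideanCLM]

/-- The Ornstein–Uhlenbeck dynamics preserves standard normal marginals. -/
theorem IsCorrelatedOU.hasLaw_coord [IsProbabilityMeasure P] (hS : S.PosSemidef)
    (hdiag : ∀ i, S i i = 1) (hz : IsCorrelatedOU S B z P)
    (hz0 : ∀ i, HasLaw (fun ω => z 0 ω i) (gaussianReal 0 1) P) (t : ℝ≥0) (i : Fin d) :
    HasLaw (fun ω => z t ω i) (gaussianReal 0 1) P := by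
  have hzm := hz.measurable
  have hproj : Measurable fun x : EuclideanSpace ℝ (Fin d) => x i := by fun_prop
  have hc : ∀ (s : ℝ≥0) (θ : ℝ), charFun (P.map fun ω => z s ω i) θ
      = charFun (P.map (z s)) (EuclideanSpace.single i θ) := by
    intro s θ
    have hzi : AEMeasurable (fun ω => z s ω i) P := (hproj.comp (hzm s)).aemeasurable
    have hc1 : Continuous fun x : ℝ => Complex.exp (inner ℝ x θ * Complex.I) := by fun_prop
    have hc2 : Continuous fun x : EuclideanSpace ℝ (Fin d) =>
      Complex.exp (inner ℝ x (EuclideanSpace.single i θ) * Complex.I) := by fun_prop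
    rw [charFun_apply, charFun_apply, integral_map hzi hc1.aestronglyMeasurable,
      integral_map (hzm s).aemeasurable hc2.aestronglyMeasurable]
    refine integral_congr_ae (ae_of_all _ fun ω => ?_)
    simp [EuclideanSpace.inner_single_right]
  refine ⟨(hproj.comp (hzm t)).aemeasurable, ?_⟩
  have : IsProbabilityMeasure (P.map fun ω => z t ω i) :=
    Measure.isProbabilityMeasure_map (hproj.comp (hzm t)).aemeasurable
  refine Measure.ext_of_charFun (funext fun θ => ?_)
  have hsmul : Real.exp (-(t : ℝ)) • EuclideanSpace.single i θ
      = EuclideanSpace.single i (Real.exp (-(t : ℝ)) * θ) := by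
    ext j; simp
  -- The unit diagonal enters here: the quadratic form of S at θ e_i is S_ii θ².
  have hq : ‖sqrtMatrixCLM S (EuclideanSpace.single i θ)‖ ^ 2 = θ ^ 2 := by
    rw [norm_sq_sqrtMatrixCLM hS]
    simp [hdiag, sq]
  rw [hc, hz.charFun_map, hsmul, ← hc, (hz0 i).map_eq, charFun_gaussianReal, charFun_gaussianReal,
    ← Complex.ofReal_pow ‖_‖, hq, ← Complex.exp_add]
  congr 1
  have e : Real.exp (-(2 * (t : ℝ))) = Real.exp (-(t : ℝ)) ^ 2 := by
    rw [← Real.exp_nat_mul]; congr 1; push_cast; ring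
  rw [e]
  push_cast
  ring

theorem copulaOf_eq_of_marginals {μ : Measure (EuclideanSpace ℝ (Fin d))}
    (h : ∀ i, μ.map (fun y => y i) = gaussianReal 0 1) :
    copulaOf μ = μ.map (fun x i => cdf (gaussianReal 0 1) (x i)) := by
  rw [copulaOf]
  congr 1
  ext x i
  rw [marginalCDF, h i]

theorem klDiv_copulaOf_le {μ ν : Measure (EuclideanSpace ℝ (Fin d))} [IsFiniteMeasure μ]
    [IsFiniteMeasure ν] (hμ : ∀ i, μ.map (fun y => y i) = gaussianReal 0 1)
    (hν : ∀ i, ν.map (fun y => y i) = gaussianReal 0 1) :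
    InformationTheory.klDiv (copulaOf μ) (copulaOf ν) ≤ InformationTheory.klDiv μ ν := by
  rw [copulaOf_eq_of_marginals hμ, copulaOf_eq_of_marginals hν]
  have hm : Measurable fun (x : EuclideanSpace ℝ (Fin d)) i => cdf (gaussianReal 0 1) (x i) :=
    measurable_pi_lambda _ fun i => (monotone_cdf _).measurable.comp (by fun_prop)
  exact InformationTheory.klDiv_map_le _ _ hm

/-- The relative entropy with respect to the invariant Gaussian law. -/
theorem IsCorrelatedOU.klDiv_map_le [IsProbabilityMeasure P] (hz : IsCorrelatedOU S B z P)
    {T : EuclideanSpace ℝ (Fin d) →L[ℝ] EuclideanSpace ℝ (Fin d)}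
    (hT : ∀ x, sqrtMatrixCLM S (T x) = x) (hL2 : ∀ i, MemLp (fun x => T x i) 2 (P.map (z 0)))
    {t : ℝ≥0} (ht : 0 < t) :
    InformationTheory.klDiv (P.map (z t)) (multivariateGaussian 0 S)
      ≤ ENNReal.ofReal (∑ i : Fin d, (-(Real.log (1 - Real.exp (-(2 * (t : ℝ)))) / 2)
        - Real.exp (-(2 * (t : ℝ))) / 2
          + Real.exp (-(2 * (t : ℝ))) * (∫ x, T x i ^ 2 ∂(P.map (z 0))) / 2)) := by
  have : IsProbabilityMeasure (P.map (z 0)) :=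
    Measure.isProbabilityMeasure_map (hz.measurable 0).aemeasurable
  have hq : Real.exp (-(2 * (t : ℝ))) < 1 := Real.exp_lt_one_iff.2 (by simpa using ht)
  set q := Real.exp (-(2 * (t : ℝ))) with hqdef
  have hσ : 0 < √(1 - q) := Real.sqrt_pos.2 (by linarith)
  set m : EuclideanSpace ℝ (Fin d) → Fin d → ℝ := fun x i => Real.exp (-(t : ℝ)) * T x i with hm
  have hmm : Measurable m := measurable_pi_lambda _ fun i => by
    have : Measurable fun x => T x i := by fun_prop
    exact this.const_mul _
  have hm2 : ∀ i, MemLp (fun x => m x i) 2 (P.map (z 0)) := fun i => (hL2 i).const_mul _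
  -- F forgets x. The initial value still reaches z_t through the shift m, as Σ^{1/2} T x = x.
  set F : EuclideanSpace ℝ (Fin d) × (Fin d → ℝ) → EuclideanSpace ℝ (Fin d) :=
    fun p => sqrtMatrixCLM S (WithLp.toLp 2 p.2) with hF
  have hFm : Measurable F := by
    have : Measurable fun w : Fin d → ℝ => sqrtMatrixCLM S (WithLp.toLp 2 w) := by fun_prop
    exact this.comp measurable_snd
  have hmap := measurable_prodMk_shift hmm (√(1 - q))
  have e1 : P.map (z t) = (((P.map (z 0)).prod (Measure.pi fun _ : Fin d => gaussianReal 0 1)).map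
      (fun p => (p.1, fun i => m p.1 i + √(1 - q) * p.2 i))).map F := by
    rw [hz.map_eq, ← map_pi_eq_stdGaussian, Measure.map_map hFm hmap]
    have h1 := Measure.map_prod_map (P.map (z 0)) (Measure.pi fun _ : Fin d => gaussianReal 0 1)
      measurable_id (WithLp.measurable_toLp 2 (Fin d → ℝ))
    rw [Measure.map_id] at h1
    rw [h1, Measure.map_map (by fun_prop) (by fun_prop)]
    congr 1
    ext1 p
    have : F (p.1, fun i => m p.1 i + √(1 - q) * p.2 i)
        = sqrtMatrixCLM S (Real.exp (-(t : ℝ)) • T p.1 + √(1 - q) • WithLp.toLp 2 p.2) := by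
      simp only [hF]
      congr 1
    rw [Function.comp_apply, Function.comp_apply, this, map_add, map_smul, map_smul, hT]
    rfl
  have e2 : multivariateGaussian 0 S
      = ((P.map (z 0)).prod (Measure.pi fun _ : Fin d => gaussianReal 0 1)).map F := by
    rw [multivariateGaussian, ← map_pi_eq_stdGaussian, Measure.map_map (by fun_prop) (by fun_prop)]
    have h2 : F = (fun w => sqrtMatrixCLM S (WithLp.toLp 2 w)) ∘ Prod.snd := rfl
    rw [h2, ← Measure.map_map (by fun_prop) measurable_snd, measurePreserving_snd.map_eq]
    congr 1
    ext1 w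
    simp [sqrtMatrixCLM]
  have hJ : IsProbabilityMeasure
      (((P.map (z 0)).prod (Measure.pi fun _ : Fin d => gaussianReal 0 1)).map
      (fun p => (p.1, fun i => m p.1 i + √(1 - q) * p.2 i))) :=
    Measure.isProbabilityMeasure_map hmap.aemeasurable
  rw [e1, e2]
  refine (InformationTheory.klDiv_map_le _ _ hFm).trans ?_
  rw [klDiv_prod_map_shift _ hmm hm2 hσ, Real.sq_sqrt (by linarith)]
  refine ENNReal.ofReal_le_ofReal (Finset.sum_le_sum fun i _ => le_of_eq ?_)
  have e3 : Real.exp (-(t : ℝ)) ^ 2 = q := by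
    rw [← Real.exp_nat_mul, hqdef]; congr 1; push_cast; ring
  simp only [hm, mul_pow]
  rw [integral_const_mul, e3]
  ring

theorem neg_log_one_sub_le {q : ℝ} (hq0 : 0 ≤ q) (hq : q ≤ 1 / 2) : -Real.log (1 - q) ≤ 2 * q := by
  have h := Real.one_sub_inv_le_log_of_pos (x := 1 - q) (by linarith)
  have h2 : (1 - q)⁻¹ ≤ 1 + 2 * q := by
    rw [inv_le_iff_one_le_mul₀ (by linarith)]
    nlinarith
  linarith

theorem IsCorrelatedOU.exists_klDiv_copulaOf_le [IsProbabilityMeasure P] (hS : S.PosDef)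
    (hdiag : ∀ i, S i i = 1) (hz : IsCorrelatedOU S B z P)
    (hz0 : ∀ i, HasLaw (fun ω => z 0 ω i) (gaussianReal 0 1) P) :
    ∃ C : ℝ, ∀ᶠ t : ℝ≥0 in atTop,
      InformationTheory.klDiv (copulaOf (P.map (z t))) (gaussianCopula S) ≤
        ENNReal.ofReal (C * Real.exp (-2 * (t : ℝ))) := by
  obtain ⟨T, hT⟩ := exists_rightInverse_sqrtMatrixCLM hS
  have hid : MemLp (fun x : EuclideanSpace ℝ (Fin d) => x) 2 (P.map (z 0)) := by
    refine (memLp_map_measure_iff aestronglyMeasurable_id (hz.measurable 0).aemeasurable).2 ?_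
    exact MemLp.of_eval_piLp fun i => (hz0 i).hasGaussianLaw.memLp_two
  have hL2 : ∀ i, MemLp (fun x => T x i) 2 (P.map (z 0)) := fun i =>
    ((EuclideanSpace.proj i).comp T).comp_memLp' hid
  -- For q ≤ 1/2, -log(1 - q)/2 ≤ q gives the 1; the term -q/2 is dropped.
  refine ⟨∑ i : Fin d, (1 + (∫ x, T x i ^ 2 ∂(P.map (z 0))) / 2), ?_⟩
  have hlim : Tendsto (fun t : ℝ≥0 => Real.exp (-(2 * (t : ℝ)))) atTop (𝓝 0) :=
    Real.tendsto_exp_neg_atTop_nhds_zero.comp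
      (NNReal.tendsto_coe_atTop.2 tendsto_id |>.const_mul_atTop two_pos)
  filter_upwards [hlim.eventually_le_const (by norm_num : (0 : ℝ) < 1 / 2), eventually_gt_atTop 0]
    with t hq ht
  have : IsProbabilityMeasure (P.map (z t)) :=
    Measure.isProbabilityMeasure_map (hz.measurable t).aemeasurable
  refine (klDiv_copulaOf_le (fun i => ?_) fun i => ?_).trans
    ((hz.klDiv_map_le hT hL2 ht).trans (ENNReal.ofReal_le_ofReal ?_))
  · rw [Measure.map_map (by fun_prop) (hz.measurable t)]
    exact (hz.hasLaw_coord hS.posSemidef hdiag hz0 t i).map_eq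
  · have := (measurePreserving_eval_multivariateGaussian (μ := 0) hS.posSemidef (i := i)).map_eq
    simpa [hdiag] using this
  · rw [Finset.sum_mul]
    refine Finset.sum_le_sum fun i _ => ?_
    have h1 := neg_log_one_sub_le (Real.exp_pos _).le hq
    have h2 : Real.exp (-2 * (t : ℝ)) = Real.exp (-(2 * (t : ℝ))) := by rw [neg_mul]
    rw [h2]
    nlinarith [Real.exp_pos (-(2 * (t : ℝ)))]

end Main

theorem mainTheorem7 {Ω : Type*} [MeasurableSpace Ω] (P : Measure Ω) [IsProbabilityMeasure P]
    (d : ℕ) (S : Matrix (Fin d) (Fin d) ℝ) (hS : S.PosDef) (hdiag : ∀ i, S i i = 1)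
    (B z : ℝ≥0 → Ω → EuclideanSpace ℝ (Fin d)) (hz : IsCorrelatedOU S B z P)
    (hz0 : ∀ i, HasLaw (fun ω => z 0 ω i) (gaussianReal 0 1) P) :
    (∀ (t : ℝ≥0) (i : Fin d),
      pdf.IsUniform (fun ω => cdf (gaussianReal 0 1) (z t ω i)) (Set.Ioo (0 : ℝ) 1) P volume) ∧
    Tendsto (fun t : ℝ≥0 => InformationTheory.klDiv (copulaOf (P.map (z t))) (gaussianCopula S))
      atTop (𝓝 0) ∧
    ∃ C : ℝ, ∀ᶠ t : ℝ≥0 in atTop,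
      InformationTheory.klDiv (copulaOf (P.map (z t))) (gaussianCopula S) ≤
        ENNReal.ofReal (C * Real.exp (-2 * (t : ℝ))) := by
  have hkl := hz.exists_klDiv_copulaOf_le hS hdiag hz0
  refine ⟨fun t i => isUniform_cdf_gaussianReal (hz.hasLaw_coord hS.posSemidef hdiag hz0 t i),
    ?_, hkl⟩
  obtain ⟨C, hC⟩ := hkl
  have hlim : Tendsto (fun t : ℝ≥0 => ENNReal.ofReal (C * Real.exp (-2 * (t : ℝ)))) atTop (𝓝 0) := by
    have h : Tendsto (fun t : ℝ≥0 => Real.exp (-2 * (t : ℝ))) atTop (𝓝 0) :=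
      Real.tendsto_exp_atBot.comp
        ((NNReal.tendsto_coe_atTop.2 tendsto_id).const_mul_atTop_of_neg (by norm_num))
    simpa using ENNReal.tendsto_ofReal (h.const_mul C)
  exact tendsto_of_tendsto_of_tendsto_of_le_of_le' tendsto_const_nhds hlim
    (Eventually.of_forall fun _ => zero_le) hC
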